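/- All $C^*$-algebras are complex, and all tensor products of unital $C^*$-algebras are maximal: the tensor product of a finite or infinite family of unital $C^*$-algebras is the universal unital $C^*$-algebra generated by mutually commuting copies of the members of the family with a common unit. $A\otimes P^{\otimes n}$, $A\otimes P^{\otimes\infty}$ and $P^{\otimes\infty}$ denote, respectively, the tensor products of $A$ and $n$ copies of $P$, of $A$ and a sequence of copies of $P$, and of a sequence of copies of $P$. The unital free product of a family of unital $C^*$-algebras is the universal unital $C^*$-algebra generated by copies of the members of the family with a common unit and no other relations; it has a canonical quotient map onto the tensor product of the same family, which is the identity on each copy. A separable $C^*$-algebra $A$ is semiprojective if for every $C^*$-algebra $D$, every increasing sequence $(J_n)$ of closed two-sided ideals of $D$, with $J=\overline{\bigcup_n J_n}$, and every (not necessarily unital) $*$-homomorphism $\phi:A\to D/J$ there are an $n$ and a $*$-homomorphism $\psi:A\to D/J_n$ whose composition with the quotient map $D/J_n\to D/J$ is $\phi$. **Theorem.** Let $A$ and $P$ be separable unital $C^*$-algebras such that 1. $P$ is isomorphic to $P^{\otimes\infty}$; 2. $A$ is semiprojective, and $A\otimes P$ is isomorphic to $A$. Let $Q$ be the unital free product of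 $A$ and a sequence of copies of $P$, and let $\pi:Q\to A\otimes P^{\otimes\infty}$ be the canonical quotient map. Then $\pi$ splits unitally, i.e. there is a unital $*$-homomorphism $\sigma:A\otimes P^{\otimes\infty}\to Q$ with $\pi\circ\sigma=\mathrm{id}$. Moreover, for every $n$, the canonical quotient map $\pi_n:A*_{\mathbb C}P*_{\mathbb C}\cdots*_{\mathbb C}P\to A\otimes P^{\otimes n}$ ($n$ copies of $P$) splits unitally, i.e. there is a unital $*$-homomorphism $\sigma_n:A\otimes P^{\otimes n}\to A*_{\mathbb C}P*_{\mathbb C}\cdots*_{\mathbb C}P$ with $\pi_n\circ\sigma_n=\mathrm{id}$. -/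

import Mathlib

universe u v w

noncomputable section

/-! ### The free unital complex star-algebra on a set with involution -/

/-- Noncommutative polynomials over `ℂ` in the elements of `X`.  This is a copy of
`FreeAlgebra ℂ X`, which carries the conjugate-linear involution induced by the one of `X`. -/
def StarPoly (X : Type w) : Type w := FreeAlgebra ℂ X

/-- The opposite algebra, with scalars acting through complex conjugation. -/
def ConjOp (X : Type w) : Type w := (FreeAlgebra ℂ X)ᵐᵒᵖ

namespace StarPoly

variable {X : Type w}

instance : Ring (StarPoly X) := inferInstanceAs (Ring (FreeAlgebra ℂ X))

instance : Algebra ℂ (StarPoly X) := inferInstanceAs (Algebra ℂ (FreeAlgebra ℂ X))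

instance : Ring (ConjOp X) := inferInstanceAs (Ring (FreeAlgebra ℂ X)ᵐᵒᵖ)

instance : Algebra ℂ (ConjOp X) :=
  ((algebraMap ℂ (FreeAlgebra ℂ X)ᵐᵒᵖ).comp (starRingEnd ℂ)).toAlgebra'
    fun _ x => Algebra.commutes (R := ℂ) (A := (FreeAlgebra ℂ X)ᵐᵒᵖ) _ x

/-- The generator given by an element of `X`. -/
def var (x : X) : StarPoly X := FreeAlgebra.ι ℂ x

/-- The unital algebra homomorphism with prescribed values on the generators. -/
def lift {B : Type*} [Ring B] [Algebra ℂ B] (f : X → B) : StarPoly X →ₐ[ℂ] B :=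
  FreeAlgebra.lift ℂ f

@[simp] theorem lift_var {B : Type*} [Ring B] [Algebra ℂ B] (f : X → B) (x : X) :
    lift f (StarPoly.var x) = f x := FreeAlgebra.lift_ι_apply f x

theorem induction {C : StarPoly X → Prop} (h_scalar : ∀ c : ℂ, C (algebraMap ℂ _ c))
    (h_gen : ∀ x, C (StarPoly.var x)) (h_mul : ∀ a b, C a → C b → C (a * b))
    (h_add : ∀ a b, C a → C b → C (a + b)) (a : StarPoly X) : C a :=
  FreeAlgebra.induction ℂ X (motive := C) h_scalar h_gen h_mul h_add a

variable [InvolutiveStar X]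

/-- The passage to the opposite algebra. -/
def toConjOp (a : StarPoly X) : ConjOp X := MulOpposite.op (α := FreeAlgebra ℂ X) a

/-- The passage back from the opposite algebra. -/
def ofConjOp (a : ConjOp X) : StarPoly X := MulOpposite.unop (α := FreeAlgebra ℂ X) a

/-- The involution, as a homomorphism into the conjugate opposite algebra. -/
def starAux : StarPoly X →ₐ[ℂ] ConjOp X :=
  lift fun x => toConjOp (StarPoly.var (star x))

instance : Star (StarPoly X) where
  star a := ofConjOp (starAux a)

theorem star_def (a : StarPoly X) :
    star a = ofConjOp (starAux a) := rfl

theorem star_mul_aux (a b : StarPoly X) : star (a * b) = star b * star a := by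
  rw [star_def, map_mul]; rfl

theorem star_add_aux (a b : StarPoly X) : star (a + b) = star a + star b := by
  rw [star_def, map_add]; rfl

@[simp] theorem star_var (x : X) : star (StarPoly.var x) = StarPoly.var (star x) := by
  rw [star_def, starAux, lift_var]; rfl

theorem star_scalar (c : ℂ) :
    star (algebraMap ℂ (StarPoly X) c) = algebraMap ℂ (StarPoly X) (star c) := by
  rw [star_def, AlgHom.commutes]; rfl

instance : StarRing (StarPoly X) where
  star_involutive a := by
    induction a using StarPoly.induction with
    | h_scalar c => simp [star_scalar]
    | h_gen x => simp
    | h_mul a b ha hb => rw [star_mul_aux, star_mul_aux, ha, hb]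
    | h_add a b ha hb => rw [star_add_aux, star_add_aux, ha, hb]
  star_mul := star_mul_aux
  star_add := star_add_aux

instance : StarModule ℂ (StarPoly X) where
  star_smul c a := by
    rw [Algebra.smul_def, star_mul_aux, star_scalar, ← Algebra.commutes, Algebra.smul_def]

theorem lift_star {B : Type*} [Ring B] [Algebra ℂ B] [StarRing B] [StarModule ℂ B] (f : X → B)
    (hf : ∀ x, f (star x) = star (f x)) (a : StarPoly X) : lift f (star a) = star (lift f a) := by
  induction a using StarPoly.induction with
  | h_scalar c => rw [star_scalar, AlgHom.commutes, AlgHom.commutes, algebraMap_star_comm]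
  | h_gen x => simp [hf]
  | h_mul a b ha hb => rw [star_mul, map_mul, map_mul, star_mul, ha, hb]
  | h_add a b ha hb => rw [star_add, map_add, map_add, star_add, ha, hb]

end StarPoly

/-! ### Universal unital C*-algebras generated by unital copies of given C*-algebras -/

section Universal

variable {ι : Type v} (A : ι → Type u) [∀ i, CStarAlgebra (A i)]

instance : InvolutiveStar (Σ i, A i) where
  star x := ⟨x.1, star x.2⟩
  star_involutive x := by simp

/-- Noncommutative polynomials in the elements of all the algebras `A i`. -/
abbrev FamPoly : Type (max u v) := StarPoly (Σ i, A i)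

variable {A} in
/-- The element `a` of the `i`-th algebra, as a generator. -/
def gen (i : ι) (a : A i) : FamPoly A := StarPoly.var ⟨i, a⟩

/-- C*-seminorms on the polynomials which come from a unital C*-algebra generated by the images of
unital *-homomorphisms from all the `A i` in which all elements of `R` become zero.  (The bound
`p (gen i a) ≤ ‖a‖` is automatic for *-homomorphisms between C*-algebras.) -/
structure IsRepSeminorm (R : Set (FamPoly A)) (p : Seminorm ℂ (FamPoly A)) : Prop where
  mul_le : ∀ x y, p (x * y) ≤ p x * p y
  cstar : ∀ x, p (star x * x) = p x * p x
  gen_le : ∀ i a, p (gen i a) ≤ ‖a‖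
  gen_add : ∀ i a b, p (gen i (a + b) - (gen i a + gen i b)) = 0
  gen_smul : ∀ i (c : ℂ) a, p (gen i (c • a) - c • gen i a) = 0
  gen_mul : ∀ i a b, p (gen i (a * b) - gen i a * gen i b) = 0
  gen_one : ∀ i, p (gen i 1 - 1) = 0
  rel : ∀ r ∈ R, p r = 0

/-- The set of all seminorms as in `IsRepSeminorm`. -/
abbrev RepSeminorm (R : Set (FamPoly A)) : Type (max u v) :=
  {p : Seminorm ℂ (FamPoly A) // IsRepSeminorm A R p}

namespace RepSeminorm

variable {A} {R : Set (FamPoly A)}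

instance : Nonempty (RepSeminorm A R) :=
  ⟨⟨0, by constructor <;> simp⟩⟩

theorem one_le (p : RepSeminorm A R) : p.1 1 ≤ 1 := by
  have h : p.1 1 = p.1 1 * p.1 1 := by
    have := p.2.cstar 1
    rwa [star_one, one_mul] at this
  nlinarith [apply_nonneg p.1 1]

theorem star_le (p : RepSeminorm A R) (x : FamPoly A) : p.1 (star x) ≤ p.1 x := by
  have h1 : p.1 (x * star x) = p.1 (star x) * p.1 (star x) := by
    have := p.2.cstar (star x)
    rwa [star_star] at this
  have h2 : p.1 (x * star x) ≤ p.1 x * p.1 (star x) := p.2.mul_le _ _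
  rcases (apply_nonneg p.1 (star x)).eq_or_lt with h | h
  · rw [← h]; exact apply_nonneg _ _
  · exact le_of_mul_le_mul_right (h1 ▸ h2) h

theorem bddAbove (x : FamPoly A) : BddAbove (Set.range fun p : RepSeminorm A R => p.1 x) := by
  suffices h : ∃ C : ℝ, 0 ≤ C ∧ ∀ p : RepSeminorm A R, p.1 x ≤ C by
    obtain ⟨C, -, h⟩ := h
    exact ⟨C, by rintro _ ⟨p, rfl⟩; exact h p⟩
  induction x using StarPoly.induction with
  | h_scalar c =>
    refine ⟨‖c‖, norm_nonneg _, fun p => ?_⟩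
    rw [Algebra.algebraMap_eq_smul_one, map_smul_eq_mul]
    exact mul_le_of_le_one_right (norm_nonneg _) p.one_le
  | h_gen x => exact ⟨‖x.2‖, norm_nonneg _, fun p => p.2.gen_le x.1 x.2⟩
  | h_mul a b ha hb =>
    obtain ⟨C, hC, ha⟩ := ha
    obtain ⟨D, hD, hb⟩ := hb
    exact ⟨C * D, mul_nonneg hC hD, fun p => (p.2.mul_le a b).trans
      (mul_le_mul (ha p) (hb p) (apply_nonneg _ _) hC)⟩
  | h_add a b ha hb =>
    obtain ⟨C, hC, ha⟩ := ha
    obtain ⟨D, hD, hb⟩ := hb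
    exact ⟨C + D, add_nonneg hC hD, fun p => (map_add_le_add p.1 a b).trans
      (add_le_add (ha p) (hb p))⟩

end RepSeminorm

variable (R : Set (FamPoly A))

/-- The universal C*-seminorm: the largest of all the seminorms as in `IsRepSeminorm`. -/
def univSeminorm : Seminorm ℂ (FamPoly A) :=
  Seminorm.of (fun x => ⨆ p : RepSeminorm A R, p.1 x)
    (fun x y => ciSup_le fun p => (map_add_le_add p.1 x y).trans
      (add_le_add (le_ciSup (RepSeminorm.bddAbove x) p) (le_ciSup (RepSeminorm.bddAbove y) p)))
    (fun c x => by
      simp_rw [map_smul_eq_mul]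
      exact (Real.mul_iSup_of_nonneg (norm_nonneg c) _).symm)

variable {A R}

theorem univSeminorm_apply (x : FamPoly A) :
    univSeminorm A R x = ⨆ p : RepSeminorm A R, p.1 x := rfl

theorem RepSeminorm.le_univSeminorm (p : RepSeminorm A R) (x : FamPoly A) :
    p.1 x ≤ univSeminorm A R x := le_ciSup (RepSeminorm.bddAbove x) p

theorem univSeminorm_eq_zero {x : FamPoly A} (h : ∀ p, IsRepSeminorm A R p → p x = 0) :
    univSeminorm A R x = 0 := by
  rw [univSeminorm_apply]
  simp [h _ (Subtype.prop _)]

/-- The universal seminorm is itself one of the seminorms of which it is the supremum. -/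
theorem univSeminorm_isRepSeminorm : IsRepSeminorm A R (univSeminorm A R) where
  mul_le x y := ciSup_le fun p => (p.2.mul_le x y).trans
    (mul_le_mul (p.le_univSeminorm x) (p.le_univSeminorm y) (apply_nonneg _ _) (apply_nonneg _ _))
  cstar x := by
    refine le_antisymm (ciSup_le fun p => ?_) ?_
    · rw [p.2.cstar]
      exact mul_self_le_mul_self (apply_nonneg _ _) (p.le_univSeminorm x)
    · have h : univSeminorm A R x ≤ √(univSeminorm A R (star x * x)) := by
        refine ciSup_le fun p => Real.le_sqrt_of_sq_le ?_
        rw [sq, ← p.2.cstar]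
        exact p.le_univSeminorm _
      have h2 := mul_self_le_mul_self (apply_nonneg _ _) h
      rwa [Real.mul_self_sqrt (apply_nonneg _ _)] at h2
  gen_le i a := ciSup_le fun p => p.2.gen_le i a
  gen_add i a b := univSeminorm_eq_zero fun _ hp => hp.gen_add i a b
  gen_smul i c a := univSeminorm_eq_zero fun _ hp => hp.gen_smul i c a
  gen_mul i a b := univSeminorm_eq_zero fun _ hp => hp.gen_mul i a b
  gen_one i := univSeminorm_eq_zero fun _ hp => hp.gen_one i
  rel r hr := univSeminorm_eq_zero fun _ hp => hp.rel r hr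

theorem univSeminorm_star (x : FamPoly A) : univSeminorm A R (star x) = univSeminorm A R x :=
  le_antisymm (RepSeminorm.star_le ⟨_, univSeminorm_isRepSeminorm⟩ x)
    (by simpa using RepSeminorm.star_le ⟨_, univSeminorm_isRepSeminorm (R := R)⟩ (star x))

variable (A R)

/-- The polynomials, with the universal C*-seminorm. -/
def PreUniv (_R : Set (FamPoly A)) : Type (max u v) := FamPoly A

instance : Ring (PreUniv A R) := inferInstanceAs (Ring (FamPoly A))

instance : Algebra ℂ (PreUniv A R) := inferInstanceAs (Algebra ℂ (FamPoly A))

instance : StarRing (PreUniv A R) := inferInstanceAs (StarRing (FamPoly A))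

instance : SeminormedRing (PreUniv A R) :=
  { (inferInstance : Ring (PreUniv A R)),
    AddGroupSeminorm.toSeminormedAddCommGroup
      (E := PreUniv A R) (univSeminorm A R).toAddGroupSeminorm with
    norm_mul_le := univSeminorm_isRepSeminorm.mul_le }

variable {A R}

instance : NormedAlgebra ℂ (PreUniv A R) where
  norm_smul_le c x := (map_smul_eq_mul (univSeminorm A R) c x).le

theorem PreUniv.uniformContinuous_star : UniformContinuous (star : PreUniv A R → PreUniv A R) :=
  (AddMonoidHomClass.isometry_of_norm (starAddEquiv : PreUniv A R ≃+ PreUniv A R)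
    univSeminorm_star).uniformContinuous

variable (A R)

/-- The universal unital C*-algebra generated by unital copies of the `A i`, subject to the
relations `r = 0` for `r ∈ R`: the Hausdorff completion of the polynomials in the universal
C*-seminorm. -/
def UniversalCStar : Type (max u v) := UniformSpace.Completion (PreUniv A R)

namespace UniversalCStar

open UniformSpace

instance : NormedRing (UniversalCStar A R) :=
  inferInstanceAs (NormedRing (Completion (PreUniv A R)))

instance : CompleteSpace (UniversalCStar A R) :=
  inferInstanceAs (CompleteSpace (Completion (PreUniv A R)))

instance : NormedAlgebra ℂ (UniversalCStar A R) :=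
  { (inferInstanceAs (Algebra ℂ (Completion (PreUniv A R))) : Algebra ℂ (UniversalCStar A R)) with
    norm_smul_le := fun c x => norm_smul_le (β := Completion (PreUniv A R)) c x }

variable {A R}

/-- The class of a polynomial in the universal C*-algebra. -/
def mk : FamPoly A →ₐ[ℂ] UniversalCStar A R where
  toFun x := ((show PreUniv A R from x : PreUniv A R) : Completion (PreUniv A R))
  map_one' := rfl
  map_zero' := rfl
  map_mul' x y := Completion.coe_mul (α := PreUniv A R) x y
  map_add' x y := Completion.coe_add (α := PreUniv A R) x y
  commutes' _ := rfl

theorem norm_mk (x : FamPoly A) : ‖(mk x : UniversalCStar A R)‖ = univSeminorm A R x :=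
  Completion.norm_coe (E := PreUniv A R) x

theorem denseRange_mk : DenseRange (mk : FamPoly A → UniversalCStar A R) :=
  Completion.denseRange_coe (α := PreUniv A R)

theorem mk_eq_zero {x : FamPoly A} (h : univSeminorm A R x = 0) :
    (mk x : UniversalCStar A R) = 0 := by
  rw [← norm_eq_zero, norm_mk, h]

theorem mk_rel {r : FamPoly A} (hr : r ∈ R) : (mk r : UniversalCStar A R) = 0 :=
  mk_eq_zero (univSeminorm_isRepSeminorm.rel r hr)

instance : Star (UniversalCStar A R) where
  star := Completion.map (star : PreUniv A R → PreUniv A R)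

theorem continuous_star : Continuous (star : UniversalCStar A R → UniversalCStar A R) :=
  Completion.continuous_map

theorem star_mk (x : FamPoly A) : star (mk x : UniversalCStar A R) = mk (star x) :=
  Completion.map_coe PreUniv.uniformContinuous_star x

instance : StarRing (UniversalCStar A R) where
  star_involutive x := by
    refine denseRange_mk.induction_on x
      (isClosed_eq (continuous_star.comp continuous_star) continuous_id) fun a => ?_
    rw [star_mk, star_mk, star_star]
  star_mul x y := by
    refine denseRange_mk.induction_on₂ (isClosed_eq (continuous_star.comp continuous_mul)
      ((continuous_star.comp continuous_snd).mul (continuous_star.comp continuous_fst)))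
      (fun a b => ?_) x y
    rw [star_mk, star_mk, ← map_mul, ← map_mul, star_mk, star_mul]
  star_add x y := by
    refine denseRange_mk.induction_on₂ (isClosed_eq (continuous_star.comp continuous_add)
      ((continuous_star.comp continuous_fst).add (continuous_star.comp continuous_snd)))
      (fun a b => ?_) x y
    rw [star_mk, star_mk, ← map_add, ← map_add, star_mk, star_add]

instance : CStarAlgebra (UniversalCStar A R) where
  norm_mul_self_le x := by
    refine denseRange_mk.induction_on x (isClosed_le (continuous_norm.mul continuous_norm)
      (continuous_norm.comp (continuous_star.mul continuous_id))) fun a => ?_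
    rw [star_mk, ← map_mul, norm_mk, norm_mk, univSeminorm_isRepSeminorm.cstar]
  star_smul c x := by
    refine denseRange_mk.induction_on x (isClosed_eq (continuous_star.comp (continuous_const_smul c))
      (continuous_star.const_smul (star c))) fun a => ?_
    rw [star_mk, ← map_smul, star_mk, star_smul, map_smul]

/-- The canonical unital *-homomorphism from the `i`-th algebra. -/
def of (i : ι) : A i →⋆ₐ[ℂ] UniversalCStar A R where
  toFun a := mk (gen i a)
  map_one' := by
    rw [← sub_eq_zero, ← map_one mk, ← map_sub]
    exact mk_eq_zero (univSeminorm_isRepSeminorm.gen_one i)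
  map_mul' a b := by
    rw [← sub_eq_zero, ← map_mul, ← map_sub]
    exact mk_eq_zero (univSeminorm_isRepSeminorm.gen_mul i a b)
  map_zero' := by
    have h := mk_eq_zero (univSeminorm_isRepSeminorm (R := R).gen_smul i 0 0)
    simpa using h
  map_add' a b := by
    rw [← sub_eq_zero, ← map_add, ← map_sub]
    exact mk_eq_zero (univSeminorm_isRepSeminorm.gen_add i a b)
  commutes' c := by
    have h1 := mk_eq_zero (univSeminorm_isRepSeminorm (R := R).gen_smul i c 1)
    have h2 := mk_eq_zero (univSeminorm_isRepSeminorm (R := R).gen_one i)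
    rw [map_sub, sub_eq_zero] at h1 h2
    rw [Algebra.algebraMap_eq_smul_one, h1, map_smul, h2, map_one, Algebra.algebraMap_eq_smul_one]
  map_star' a := by
    rw [star_mk, gen, gen, StarPoly.star_var]; rfl

theorem of_apply (i : ι) (a : A i) : (of i a : UniversalCStar A R) = mk (gen i a) := rfl

section Lift

variable {C : Type w} [CStarAlgebra C] (f : ∀ i, A i →⋆ₐ[ℂ] C)

/-- Evaluation of polynomials along a family of unital *-homomorphisms. -/
def evalPoly : FamPoly A →ₐ[ℂ] C := StarPoly.lift fun x => f x.1 x.2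

@[simp] theorem evalPoly_gen (i : ι) (a : A i) : evalPoly f (gen i a) = f i a :=
  StarPoly.lift_var _ _

theorem evalPoly_star (x : FamPoly A) : evalPoly f (star x) = star (evalPoly f x) :=
  StarPoly.lift_star _ (fun x => map_star (f x.1) x.2) x

variable {f} in
theorem norm_evalPoly_le (hf : ∀ r ∈ R, evalPoly f r = 0) (x : FamPoly A) :
    ‖evalPoly f x‖ ≤ univSeminorm A R x := by
  let p : Seminorm ℂ (FamPoly A) := (normSeminorm ℂ C).comp (evalPoly f).toLinearMap
  have hp : ∀ x, p x = ‖evalPoly f x‖ := fun _ => rfl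
  refine RepSeminorm.le_univSeminorm ⟨p, ?_⟩ x
  constructor
  · intro x y; simp only [hp, map_mul]; exact norm_mul_le _ _
  · intro x; simp only [hp, map_mul, evalPoly_star]; exact CStarRing.norm_star_mul_self
  · intro i a; simp only [hp, evalPoly_gen]; exact NonUnitalStarAlgHom.norm_apply_le (f i) a
  · intro i a b; simp [hp]
  · intro i c a; simp [hp]
  · intro i a b; simp [hp]
  · intro i; simp [hp]
  · intro r hr; simp [hp, hf r hr]

variable {f} in
theorem uniformContinuous_evalPoly (hf : ∀ r ∈ R, evalPoly f r = 0) :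
    UniformContinuous (fun x : PreUniv A R => evalPoly f x) :=
  AddMonoidHomClass.uniformContinuous_of_bound
    (show PreUniv A R →+ C from (evalPoly f).toLinearMap.toAddMonoidHom) 1
    fun x => by rw [one_mul]; exact norm_evalPoly_le hf x

/-- The underlying map of `lift`: the continuous extension of the evaluation of polynomials. -/
def liftFun : UniversalCStar A R → C :=
  Completion.extension (fun x : PreUniv A R => evalPoly f x)

theorem continuous_liftFun : Continuous (liftFun f : UniversalCStar A R → C) :=
  Completion.continuous_extension

variable {f} in
theorem liftFun_mk (hf : ∀ r ∈ R, evalPoly f r = 0) (x : FamPoly A) :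
    liftFun f (mk x : UniversalCStar A R) = evalPoly f x :=
  Completion.extension_coe (uniformContinuous_evalPoly hf) x

/-- The universal property: a family of unital *-homomorphisms into a unital C*-algebra which
satisfies the relations extends to a unital *-homomorphism on the universal C*-algebra. -/
def lift (hf : ∀ r ∈ R, evalPoly f r = 0) : UniversalCStar A R →⋆ₐ[ℂ] C where
  toFun := liftFun f
  map_one' := by rw [← map_one mk, liftFun_mk hf, map_one]
  map_mul' x y := by
    refine denseRange_mk.induction_on₂ (isClosed_eq ((continuous_liftFun f).comp continuous_mul)
      (((continuous_liftFun f).comp continuous_fst).mul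
        ((continuous_liftFun f).comp continuous_snd))) (fun a b => ?_) x y
    rw [← map_mul, liftFun_mk hf, liftFun_mk hf, liftFun_mk hf, map_mul]
  map_zero' := by rw [← map_zero mk, liftFun_mk hf, map_zero]
  map_add' x y := by
    refine denseRange_mk.induction_on₂ (isClosed_eq ((continuous_liftFun f).comp continuous_add)
      (((continuous_liftFun f).comp continuous_fst).add
        ((continuous_liftFun f).comp continuous_snd))) (fun a b => ?_) x y
    rw [← map_add, liftFun_mk hf, liftFun_mk hf, liftFun_mk hf, map_add]
  commutes' c := by
    rw [← AlgHom.commutes mk, liftFun_mk hf, AlgHom.commutes]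
  map_star' x := by
    refine denseRange_mk.induction_on x (isClosed_eq ((continuous_liftFun f).comp continuous_star)
      (continuous_liftFun f).star) fun a => ?_
    rw [star_mk, liftFun_mk hf, liftFun_mk hf, evalPoly_star]

theorem lift_mk (hf : ∀ r ∈ R, evalPoly f r = 0) (x : FamPoly A) :
    lift f hf (mk x) = evalPoly f x := liftFun_mk hf x

@[simp] theorem lift_of (hf : ∀ r ∈ R, evalPoly f r = 0) (i : ι) (a : A i) :
    lift f hf (of i a) = f i a := by
  rw [of_apply, lift_mk, evalPoly_gen]

/-- The copies of the `A i` generate the universal C*-algebra. -/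
theorem hom_ext {g h : UniversalCStar A R →⋆ₐ[ℂ] C} (H : ∀ i a, g (of i a) = h (of i a)) :
    g = h := by
  have hc : ∀ k : UniversalCStar A R →⋆ₐ[ℂ] C, Continuous k := fun k =>
    AddMonoidHomClass.continuous_of_bound k 1 fun x => by
      rw [one_mul]; exact NonUnitalStarAlgHom.norm_apply_le k x
  ext x
  refine denseRange_mk.induction_on x (isClosed_eq (hc g) (hc h)) fun a => ?_
  induction a using StarPoly.induction with
  | h_scalar c => rw [AlgHom.commutes, AlgHomClass.commutes, AlgHomClass.commutes]
  | h_gen y => exact H y.1 y.2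
  | h_mul a b ha hb => rw [map_mul, map_mul, map_mul, ha, hb]
  | h_add a b ha hb => rw [map_add, map_add, map_add, ha, hb]

end Lift

end UniversalCStar

/-- The (full) unital free product of the `A i`: no relations besides the common unit. -/
abbrev UnitalFreeProduct : Type (max u v) := UniversalCStar A ∅

/-- The relations saying that the `A i` commute with each other. -/
def commRelations : Set (FamPoly A) :=
  {r | ∃ (i j : ι) (a : A i) (b : A j), i ≠ j ∧ r = gen i a * gen j b - gen j b * gen i a}

/-- The maximal tensor product of the `A i`: the universal unital C*-algebra generated by commuting
copies of the `A i` with a common unit. -/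
abbrev MaxTensorProduct : Type (max u v) := UniversalCStar A (commRelations A)

/-- The canonical quotient map from the unital free product to the maximal tensor product, which is
the identity on each `A i`. -/
def freeToTensor : UnitalFreeProduct A →⋆ₐ[ℂ] MaxTensorProduct A :=
  UniversalCStar.lift (fun _ => UniversalCStar.of _) (fun _ hr => hr.elim)

variable {A}

@[simp] theorem freeToTensor_of (i : ι) (a : A i) :
    freeToTensor A (UniversalCStar.of i a) = UniversalCStar.of i a :=
  UniversalCStar.lift_of _ _ i a

theorem MaxTensorProduct.of_commute {i j : ι} (h : i ≠ j) (a : A i) (b : A j) :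
    Commute (UniversalCStar.of i a : MaxTensorProduct A) (UniversalCStar.of j b) := by
  have := UniversalCStar.mk_rel (R := commRelations A) ⟨i, j, a, b, h, rfl⟩
  rwa [map_sub, map_mul, map_mul, sub_eq_zero] at this

end Universal

/-! ### One algebra `A` and a family of copies of another algebra `P` -/

section Copies

variable (A P : Type u) (I : Type v)

/-- The family consisting of `A` and of one copy of `P` for each element of `I`. -/
def copiesFamily : Option I → Type u
  | none => A
  | some _ => P

instance copiesFamily.cstarAlgebra [CStarAlgebra A] [CStarAlgebra P] :
    ∀ o, CStarAlgebra (copiesFamily A P I o)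
  | none => inferInstanceAs (CStarAlgebra A)
  | some _ => inferInstanceAs (CStarAlgebra P)

variable [CStarAlgebra A] [CStarAlgebra P]

/-- The unital free product of `A` and of copies of `P` indexed by `I`. -/
abbrev FreeCopies : Type (max u v) := UnitalFreeProduct (copiesFamily A P I)

/-- The maximal tensor product of `A` and of copies of `P` indexed by `I`: the universal unital
C*-algebra generated by commuting copies of these algebras with a common unit. -/
abbrev TensorCopies : Type (max u v) := MaxTensorProduct (copiesFamily A P I)

/-- The canonical quotient map from the unital free product of `A` and of copies of `P` onto the
tensor product of the same algebras. -/
abbrev copiesQuotientMap : FreeCopies A P I →⋆ₐ[ℂ] TensorCopies A P I :=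
  freeToTensor (copiesFamily A P I)

/-- The maximal tensor product `A ⊗ P`. -/
abbrev TensorPair : Type u := TensorCopies A P Unit

/-- The infinite maximal tensor power of `P`: the universal unital C*-algebra generated by a
sequence of commuting copies of `P` with a common unit. -/
abbrev InfiniteTensorPower : Type u := MaxTensorProduct (fun _ : ℕ => P)

end Copies

/-! ### Semiprojectivity -/

/-- A closed two-sided ideal of a C*-algebra.  (The last field holds automatically.) -/
structure ClosedIdeal (D : Type u) [NonUnitalCStarAlgebra D] where
  carrier : Set D
  zero_mem : 0 ∈ carrier
  add_mem : ∀ {x y}, x ∈ carrier → y ∈ carrier → x + y ∈ carrier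
  smul_mem : ∀ (c : ℂ) {x}, x ∈ carrier → c • x ∈ carrier
  mul_mem_left : ∀ (d : D) {x}, x ∈ carrier → d * x ∈ carrier
  mul_mem_right : ∀ (d : D) {x}, x ∈ carrier → x * d ∈ carrier
  isClosed : IsClosed carrier
  star_mem : ∀ {x}, x ∈ carrier → star x ∈ carrier

namespace ClosedIdeal

variable {D : Type u} [NonUnitalCStarAlgebra D]

theorem neg_mem (J : ClosedIdeal D) {x : D} (hx : x ∈ J.carrier) : -x ∈ J.carrier := by
  rw [← neg_one_smul ℂ]; exact J.smul_mem _ hx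

/-- Congruence modulo a closed ideal. -/
def con (J : ClosedIdeal D) : RingCon D where
  r x y := x - y ∈ J.carrier
  iseqv :=
    { refl := fun x => by rw [sub_self]; exact J.zero_mem
      symm := fun {x y} h => by rw [← neg_sub]; exact J.neg_mem h
      trans := fun {x y z} h k => by rw [← sub_add_sub_cancel x y z]; exact J.add_mem h k }
  add' {w x y z} h k := by
    have := J.add_mem h k
    rwa [sub_add_sub_comm] at this
  mul' {w x y z} h k := by
    have := J.add_mem (J.mul_mem_right y h) (J.mul_mem_left x k)
    rwa [sub_mul, mul_sub, sub_add_sub_cancel] at this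

/-- The quotient *-algebra `D / J`. -/
def Quot (J : ClosedIdeal D) : Type u := J.con.Quotient

instance (J : ClosedIdeal D) : NonUnitalRing J.Quot :=
  inferInstanceAs (NonUnitalRing J.con.Quotient)

theorem rel_iff (J : ClosedIdeal D) {x y : D} : J.con x y ↔ x - y ∈ J.carrier := Iff.rfl

/-- The quotient map `D → D / J`. -/
def toQuot (J : ClosedIdeal D) (x : D) : J.Quot := (x : J.con.Quotient)

theorem toQuot_surjective (J : ClosedIdeal D) : Function.Surjective J.toQuot :=
  Quotient.mk''_surjective

theorem toQuot_eq (J : ClosedIdeal D) {x y : D} : J.toQuot x = J.toQuot y ↔ x - y ∈ J.carrier :=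
  (RingCon.eq _).trans J.rel_iff

instance (J : ClosedIdeal D) : Star J.Quot where
  star := Quotient.map' star fun x y h => by
    refine J.rel_iff.2 ?_
    rw [← star_sub]
    exact J.star_mem (J.rel_iff.1 h)

instance (J : ClosedIdeal D) : SMul ℂ J.Quot where
  smul c := Quotient.map' (c • ·) fun x y h => by
    refine J.rel_iff.2 ?_
    rw [← smul_sub]
    exact J.smul_mem c (J.rel_iff.1 h)

instance (J : ClosedIdeal D) : Module ℂ J.Quot :=
  Function.Surjective.module ℂ (⟨⟨J.toQuot, rfl⟩, fun _ _ => rfl⟩ : D →+ J.Quot)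
    J.toQuot_surjective fun _ _ => rfl

/-- The quotient map, as a *-homomorphism. -/
def mkHom (J : ClosedIdeal D) : D →⋆ₙₐ[ℂ] J.Quot where
  toFun := J.toQuot
  map_smul' _ _ := rfl
  map_zero' := rfl
  map_add' _ _ := rfl
  map_mul' _ _ := rfl
  map_star' _ := rfl

/-- The canonical *-homomorphism `D / J → D / K` for ideals `J ⊆ K`. -/
def factor (J K : ClosedIdeal D) (h : J.carrier ⊆ K.carrier) : J.Quot →⋆ₙₐ[ℂ] K.Quot where
  toFun := Quotient.map' id fun _ _ hxy => K.rel_iff.2 (h (J.rel_iff.1 hxy))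
  map_smul' c := by rintro ⟨x⟩; rfl
  map_zero' := rfl
  map_add' := by rintro ⟨x⟩ ⟨y⟩; rfl
  map_mul' := by rintro ⟨x⟩ ⟨y⟩; rfl
  map_star' := by rintro ⟨x⟩; rfl

@[simp] theorem factor_mkHom (J K : ClosedIdeal D) (h : J.carrier ⊆ K.carrier) (x : D) :
    factor J K h (J.mkHom x) = K.mkHom x := rfl

end ClosedIdeal

/-- A C*-algebra `A` is semiprojective if it is separable and, for every C*-algebra `D`, every
increasing sequence `(Jₙ)` of closed ideals of `D` with `J` the closure of their union, every
*-homomorphism `φ : A → D / J` lifts to a *-homomorphism `ψ : A → D / Jₙ` for some `n`.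
(*-homomorphisms are not required to be unital.) -/
def IsSemiprojective (A : Type u) [NonUnitalCStarAlgebra A] : Prop :=
  TopologicalSpace.SeparableSpace A ∧
  ∀ (D : Type u) [NonUnitalCStarAlgebra D] (Jn : ℕ → ClosedIdeal D) (J : ClosedIdeal D),
    (Monotone fun n => (Jn n).carrier) →
    ∀ hJ : J.carrier = closure (⋃ n, (Jn n).carrier),
    ∀ φ : A →⋆ₙₐ[ℂ] J.Quot,
      ∃ (n : ℕ) (ψ : A →⋆ₙₐ[ℂ] (Jn n).Quot),
        (ClosedIdeal.factor (Jn n) J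
          (hJ ▸ (Set.subset_iUnion (fun n => (Jn n).carrier) n).trans subset_closure)).comp ψ = φ

end

/-! ### Lifting elements along *-homomorphisms with norm control -/

section LiftNorm

variable {D : Type u} {C : Type v} [CStarAlgebra D] [CStarAlgebra C]

/-! Write `T` for `A ⊗ P^{⊗∞}`. Regrouping tensor factors with `P ≅ P^{⊗∞}` gives `T ≅ A ⊗ P ≅ A`,
and likewise `A ≅ A ⊗ P^{⊗m}` for each `m ≥ 1` (`tensorEquiv`). Hence `T` itself is semiprojective.

Let `U_m` be the quotient of the infinite free product in which only `A` and the first `m` copies of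
`P` are made to commute. The commutation relations of `T` are the increasing union of those of the
`U_m`, so the kernel of the map from the free product to `T` is the closure of the union of the
kernels of the maps to the `U_m` (`kerIdeal_factor_eq_closure`). Semiprojectivity lifts `A ≅ T` to
some `U_m`, and enlarging `m` makes the lift unital (`IsSemiprojective.exists_unital_lift`). So `U_m
→ T` splits for some `m`.

Now `U_m` is the free product of `A ⊗ P^{⊗m}` with the remaining copies of `P`. Replacing `A ⊗
P^{⊗m}` by `A` and renumbering the remaining copies turns `U_m → T` into the original quotient map
`Q → T`, which therefore splits (`exists_section_nat`).

For `n ≥ 1` copies, partition the sequence into `n` infinite groups and put each group into one copy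
of `P ≅ P^{⊗∞}`. This maps the infinite free product to the finite one, and on tensor products it is
an isomorphism, so the splitting is transported (`exists_section_of_exists_section_nat`). -/

theorem StarAlgHom.continuous_of_cstarAlgebra (f : D →⋆ₐ[ℂ] C) : Continuous f :=
  AddMonoidHomClass.continuous_of_bound f 1 fun x => by
    rw [one_mul]; exact NonUnitalStarAlgHom.norm_apply_le f x

/-- Functional calculus truncates `a` to the interval `[-‖f a‖, ‖f a‖]`. The truncation is the
identity on the spectrum of `f a`, so the image does not change. -/
theorem StarAlgHom.exists_selfAdjoint_lift_norm_le (f : D →⋆ₐ[ℂ] C) {a : D}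
    (ha : IsSelfAdjoint a) : ∃ b, f b = f a ∧ ‖b‖ ≤ ‖f a‖ := by
  have hf : Continuous f := f.continuous_of_cstarAlgebra
  have hfa : IsSelfAdjoint (f a) := ha.map f
  let g : ℝ → ℝ := fun t => max (-‖f a‖) (min ‖f a‖ t)
  have hg : Continuous g := by fun_prop
  refine ⟨cfc g a, ?_, ?_⟩
  · rw [StarAlgHomClass.map_cfc (S := ℂ) f g a hg.continuousOn hf ha hfa]
    conv_rhs => rw [← cfc_id ℝ (f a)]
    refine cfc_congr fun t ht => ?_
    -- The bound of the spectrum by the norm needs `‖1‖ = 1`; in the zero algebra the spectrum is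
    -- empty.
    have : Nontrivial C := by
      by_contra h
      rw [not_nontrivial_iff_subsingleton] at h
      simp [spectrum.of_subsingleton] at ht
    have ht' : |t| ≤ ‖f a‖ := spectrum.norm_le_norm_of_mem ht
    rw [abs_le] at ht'
    simp [g, ht']
  · refine norm_cfc_le (norm_nonneg _) fun t _ => ?_
    rw [Real.norm_eq_abs, abs_le]
    exact ⟨le_max_left _ _, max_le (by linarith [norm_nonneg (f a)]) (min_le_left _ _)⟩

/-- Real and imaginary parts are lifted separately, each with norm at most `‖f x‖`. The constant 2
is not optimal, but any constant serves. -/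
theorem StarAlgHom.exists_lift_norm_le (f : D →⋆ₐ[ℂ] C) (x : D) :
    ∃ y, f y = f x ∧ ‖y‖ ≤ 2 * ‖f x‖ := by
  obtain ⟨a, ha, ha'⟩ := f.exists_selfAdjoint_lift_norm_le (realPart x).2
  obtain ⟨b, hb, hb'⟩ := f.exists_selfAdjoint_lift_norm_le (imaginaryPart x).2
  have hr : f (realPart x : D) = (realPart (f x) : C) := by
    simp [realPart_apply_coe, map_real_smul f f.continuous_of_cstarAlgebra, map_star]
  have hi : f (imaginaryPart x : D) = (imaginaryPart (f x) : C) := by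
    simp [imaginaryPart_apply_coe, map_real_smul f f.continuous_of_cstarAlgebra, map_star]
  have h1 : ‖a‖ ≤ ‖f x‖ := ha'.trans (by rw [hr]; exact realPart.norm_le (f x))
  have h2 : ‖b‖ ≤ ‖f x‖ := hb'.trans (by rw [hi]; exact imaginaryPart.norm_le (f x))
  refine ⟨a + Complex.I • b, ?_, ?_⟩
  · rw [map_add, map_smul, ha, hb, ← map_smul, ← map_add, realPart_add_I_smul_imaginaryPart]
  · calc ‖a + Complex.I • b‖ ≤ ‖a‖ + ‖Complex.I • b‖ := norm_add_le _ _
      _ ≤ 2 * ‖f x‖ := by rw [norm_smul, Complex.norm_I]; linarith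

/-- Lifts of controlled norm and completeness of `D` make the range closed. -/
theorem StarAlgHom.surjective_of_denseRange (f : D →⋆ₐ[ℂ] C) (hf : DenseRange f) :
    Function.Surjective f := by
  let F : NormedAddGroupHom D C :=
    AddMonoidHom.mkNormedAddGroupHom (f : D →+ C) 1 fun x => by
      rw [one_mul]; exact NonUnitalStarAlgHom.norm_apply_le f x
  have hF : F.SurjectiveOnWith F.range 2 := by
    rintro _ ⟨x, rfl⟩
    exact f.exists_lift_norm_le x
  intro y
  obtain ⟨x, hx, -⟩ := controlled_closure_of_complete two_pos one_pos hF y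
    (show y ∈ closure (Set.range f) from hf y)
  exact ⟨x, hx⟩

end LiftNorm

/-! ### Kernels and the first isomorphism theorem -/

section Kernel

variable {D : Type u} {C : Type v} [CStarAlgebra D] [CStarAlgebra C]

/-- The kernel of a unital *-homomorphism, as a closed ideal. -/
noncomputable def StarAlgHom.kerIdeal (f : D →⋆ₐ[ℂ] C) : ClosedIdeal D where
  carrier := {x | f x = 0}
  zero_mem := map_zero f
  add_mem hx hy := by simp_all
  smul_mem c x hx := by simp_all
  mul_mem_left d x hx := by simp_all
  mul_mem_right d x hx := by simp_all
  isClosed := isClosed_eq (f.continuous_of_cstarAlgebra) continuous_const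
  star_mem hx := by simp_all [map_star]

theorem StarAlgHom.mem_kerIdeal {f : D →⋆ₐ[ℂ] C} {x : D} :
    x ∈ f.kerIdeal.carrier ↔ f x = 0 := Iff.rfl

/-- The injective *-homomorphism induced on the quotient by the kernel. -/
noncomputable def StarAlgHom.kerLift (f : D →⋆ₐ[ℂ] C) : f.kerIdeal.Quot →⋆ₙₐ[ℂ] C where
  toFun := Quotient.lift f fun x y (h : f (x - y) = 0) => by
    rwa [map_sub, sub_eq_zero] at h
  map_smul' c := by rintro ⟨x⟩; exact map_smul f c x
  map_zero' := map_zero f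
  map_add' := by rintro ⟨x⟩ ⟨y⟩; exact map_add f x y
  map_mul' := by rintro ⟨x⟩ ⟨y⟩; exact map_mul f x y
  map_star' := by rintro ⟨x⟩; exact map_star f x

theorem StarAlgHom.kerLift_injective (f : D →⋆ₐ[ℂ] C) : Function.Injective f.kerLift := by
  rintro ⟨x⟩ ⟨y⟩ (h : f x = f y)
  exact f.kerIdeal.toQuot_eq.2 (show f (x - y) = 0 by rw [map_sub, h, sub_self])

/-- The first isomorphism theorem. -/
noncomputable def StarAlgHom.quotKerEquiv (f : D →⋆ₐ[ℂ] C) (hf : Function.Surjective f) :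
    f.kerIdeal.Quot ≃⋆ₐ[ℂ] C :=
  StarAlgEquiv.ofBijective f.kerLift ⟨f.kerLift_injective, fun y => by
    obtain ⟨x, rfl⟩ := hf y
    exact ⟨f.kerIdeal.mkHom x, rfl⟩⟩

theorem StarAlgHom.kerLift_quotKerEquiv_symm (f : D →⋆ₐ[ℂ] C) (hf : Function.Surjective f)
    (y : C) : f.kerLift ((f.quotKerEquiv hf).symm y) = y :=
  (f.quotKerEquiv hf).apply_symm_apply y

end Kernel

/-! ### Adding relations to a universal C*-algebra -/

namespace UniversalCStar

variable {ι : Type v} {A : ι → Type u} [∀ i, CStarAlgebra (A i)]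

theorem evalPoly_of {R : Set (FamPoly A)} (x : FamPoly A) :
    evalPoly (fun i => (of i : A i →⋆ₐ[ℂ] UniversalCStar A R)) x = mk x := by
  induction x using StarPoly.induction with
  | h_scalar c => rw [AlgHom.commutes, AlgHom.commutes]
  | h_gen y => exact evalPoly_gen _ y.1 y.2
  | h_mul a b ha hb => rw [map_mul, map_mul, ha, hb]
  | h_add a b ha hb => rw [map_add, map_add, ha, hb]

/-- The quotient map onto the universal C*-algebra with more relations. -/
noncomputable def factor {R S : Set (FamPoly A)} (h : R ⊆ S) :
    UniversalCStar A R →⋆ₐ[ℂ] UniversalCStar A S :=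
  lift of fun r hr => by rw [evalPoly_of, mk_rel (h hr)]

@[simp] theorem factor_of {R S : Set (FamPoly A)} (h : R ⊆ S) (i : ι) (a : A i) :
    factor h (of i a) = of i a := lift_of _ _ i a

@[simp] theorem factor_mk {R S : Set (FamPoly A)} (h : R ⊆ S) (x : FamPoly A) :
    factor h (mk x) = mk x := by
  rw [factor, lift_mk, evalPoly_of]

theorem factor_factor {R S T : Set (FamPoly A)} (h : R ⊆ S) (k : S ⊆ T)
    (x : UniversalCStar A R) : factor k (factor h x) = factor (h.trans k) x :=
  DFunLike.congr_fun (hom_ext (g := (factor k).comp (factor h)) (h := factor (h.trans k))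
    fun i a => by simp) x

theorem factor_surjective {R S : Set (FamPoly A)} (h : R ⊆ S) :
    Function.Surjective (factor h : UniversalCStar A R →⋆ₐ[ℂ] UniversalCStar A S) := by
  refine (factor h).surjective_of_denseRange (denseRange_mk.mono ?_)
  rintro _ ⟨x, rfl⟩
  exact ⟨mk x, factor_mk h x⟩

theorem univSeminorm_mono {R S : Set (FamPoly A)} (h : R ⊆ S) (x : FamPoly A) :
    univSeminorm A S x ≤ univSeminorm A R x := by
  rw [← norm_mk, ← norm_mk, ← factor_mk h]
  exact NonUnitalStarAlgHom.norm_apply_le _ _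

/-! ### Increasing unions of sets of relations -/

section Limit

open Filter Topology

variable {R : ℕ → Set (FamPoly A)}

theorem tendsto_univSeminorm_iInf (hR : Monotone R) (x : FamPoly A) :
    Tendsto (fun n => univSeminorm A (R n) x) atTop (𝓝 (⨅ n, univSeminorm A (R n) x)) :=
  tendsto_atTop_ciInf (fun _ _ h => univSeminorm_mono (hR h) x)
    ⟨0, by rintro _ ⟨n, rfl⟩; exact apply_nonneg _ _⟩

/-- The limit of the universal seminorms of an increasing sequence of sets of relations. -/
noncomputable def limitSeminorm (hR : Monotone R) : Seminorm ℂ (FamPoly A) :=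
  Seminorm.of (fun x => ⨅ n, univSeminorm A (R n) x)
    (fun x y => le_of_tendsto_of_tendsto' (tendsto_univSeminorm_iInf hR _)
      ((tendsto_univSeminorm_iInf hR x).add (tendsto_univSeminorm_iInf hR y))
      fun n => map_add_le_add (univSeminorm A (R n)) x y)
    (fun c x => tendsto_nhds_unique (tendsto_univSeminorm_iInf hR _)
      (by simpa only [map_smul_eq_mul] using (tendsto_univSeminorm_iInf hR x).const_mul ‖c‖))

theorem tendsto_limitSeminorm (hR : Monotone R) (x : FamPoly A) :
    Tendsto (fun n => univSeminorm A (R n) x) atTop (𝓝 (limitSeminorm hR x)) :=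
  tendsto_univSeminorm_iInf hR x

theorem limitSeminorm_eq_zero (hR : Monotone R) {x : FamPoly A} {n : ℕ}
    (h : ∀ m, n ≤ m → univSeminorm A (R m) x = 0) : limitSeminorm hR x = 0 :=
  tendsto_nhds_unique (tendsto_limitSeminorm hR x)
    (tendsto_const_nhds.congr' ((eventually_ge_atTop n).mono fun m hm => (h m hm).symm))

/-- All conditions are closed under pointwise limits, and each relation of the union holds from some
index on. Being admissible for the union, the limit is at most its universal seminorm. -/
theorem limitSeminorm_isRepSeminorm (hR : Monotone R) :
    IsRepSeminorm A (⋃ n, R n) (limitSeminorm hR) where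
  mul_le x y := le_of_tendsto_of_tendsto' (tendsto_limitSeminorm hR _)
    ((tendsto_limitSeminorm hR x).mul (tendsto_limitSeminorm hR y))
    fun _ => univSeminorm_isRepSeminorm.mul_le x y
  cstar x := tendsto_nhds_unique (tendsto_limitSeminorm hR _)
    (((tendsto_limitSeminorm hR x).mul (tendsto_limitSeminorm hR x)).congr
      fun _ => (univSeminorm_isRepSeminorm.cstar x).symm)
  gen_le i a := le_of_tendsto' (tendsto_limitSeminorm hR _)
    fun _ => univSeminorm_isRepSeminorm.gen_le i a
  gen_add i a b := limitSeminorm_eq_zero hR (n := 0)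
    fun _ _ => univSeminorm_isRepSeminorm.gen_add i a b
  gen_smul i c a := limitSeminorm_eq_zero hR (n := 0)
    fun _ _ => univSeminorm_isRepSeminorm.gen_smul i c a
  gen_mul i a b := limitSeminorm_eq_zero hR (n := 0)
    fun _ _ => univSeminorm_isRepSeminorm.gen_mul i a b
  gen_one i := limitSeminorm_eq_zero hR (n := 0)
    fun _ _ => univSeminorm_isRepSeminorm.gen_one i
  rel r hr := by
    obtain ⟨n, hn⟩ := Set.mem_iUnion.1 hr
    exact limitSeminorm_eq_zero hR fun m hm => univSeminorm_isRepSeminorm.rel r (hR hm hn)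

/-- An element which vanishes in the universal C*-algebra of a union of an increasing sequence of
sets of relations is arbitrarily small modulo some of them. -/
theorem exists_norm_factor_lt (hR : Monotone R) {S T : Set (FamPoly A)} (hS : ∀ n, S ⊆ R n)
    (hT : T = ⋃ n, R n) (hST : S ⊆ T) {x : UniversalCStar A S} (hx : factor hST x = 0)
    {ε : ℝ} (hε : 0 < ε) : ∀ᶠ n in atTop, ‖factor (hS n) x‖ < ε := by
  subst hT
  obtain ⟨y, hy⟩ := denseRange_mk.exists_dist_lt x (half_pos hε)
  rw [dist_eq_norm] at hy
  have h1 : ‖factor hST (mk y)‖ < ε / 2 := by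
    refine lt_of_le_of_lt ?_ hy
    rw [← norm_neg, ← zero_sub, ← hx, ← map_sub]
    exact NonUnitalStarAlgHom.norm_apply_le _ _
  -- The limit seminorm is dominated by the universal seminorm of the union, so smallness in the
  -- limit algebra already occurs at a finite stage.
  have h2 : limitSeminorm hR y < ε / 2 := by
    rw [factor_mk, norm_mk] at h1
    exact (RepSeminorm.le_univSeminorm ⟨_, limitSeminorm_isRepSeminorm hR⟩ y).trans_lt h1
  filter_upwards [(tendsto_limitSeminorm hR y).eventually_lt_const h2] with n hn
  calc ‖factor (hS n) x‖ = ‖factor (hS n) (x - mk y) + factor (hS n) (mk y)‖ := by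
        rw [← map_add, sub_add_cancel]
    _ ≤ ‖factor (hS n) (x - mk y)‖ + ‖factor (hS n) (mk y)‖ := norm_add_le _ _
    _ < ε / 2 + ε / 2 := by
        refine add_lt_add ((NonUnitalStarAlgHom.norm_apply_le _ _).trans_lt hy) ?_
        rwa [factor_mk, norm_mk]
    _ = ε := add_halves ε

/-- An `x` in the kernel for `T` has small image at some stage `n`. Subtracting a small lift `y` of
that image puts `x - y` in the `n`-th kernel. Asking for an image below `ε / 2` absorbs the factor 2
of `exists_lift_norm_le`. -/
theorem kerIdeal_factor_eq_closure (hR : Monotone R) {S T : Set (FamPoly A)} (hS : ∀ n, S ⊆ R n)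
    (hT : T = ⋃ n, R n) (hST : S ⊆ T) :
    (factor hST).kerIdeal.carrier = closure (⋃ n, (factor (hS n)).kerIdeal.carrier) := by
  have hRT : ∀ n, R n ⊆ T := fun n => hT ▸ Set.subset_iUnion R n
  refine Set.Subset.antisymm (fun x hx => ?_) ?_
  · refine Metric.mem_closure_iff.2 fun ε hε => ?_
    obtain ⟨n, hn⟩ := (exists_norm_factor_lt hR hS hT hST (StarAlgHom.mem_kerIdeal.1 hx)
      (half_pos hε)).exists
    obtain ⟨y, hy, hy'⟩ := (factor (hS n)).exists_lift_norm_le x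
    refine ⟨x - y, Set.mem_iUnion.2 ⟨n, ?_⟩, ?_⟩
    · rw [StarAlgHom.mem_kerIdeal, map_sub, hy, sub_self]
    · rw [dist_eq_norm, sub_sub_cancel]
      linarith
  · refine closure_minimal (Set.iUnion_subset fun n x hx => ?_) (factor hST).kerIdeal.isClosed
    rw [StarAlgHom.mem_kerIdeal] at hx ⊢
    rw [← factor_factor (hS n) (hRT n), hx, map_zero]

theorem kerIdeal_factor_mono (hR : Monotone R) {S : Set (FamPoly A)} (hS : ∀ n, S ⊆ R n) :
    Monotone fun n => (factor (hS n)).kerIdeal.carrier := by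
  intro n m h x hx
  rw [StarAlgHom.mem_kerIdeal] at hx ⊢
  rw [← factor_factor (hS n) (hR h), hx, map_zero]

end Limit

end UniversalCStar

/-! ### Unital lifts from semiprojectivity -/

section Lifting

open Filter

/-- The C*-identity gives `‖p‖ = ‖p‖²`, so the norm of a projection is 0 or 1. -/
theorem IsSelfAdjoint.eq_zero_of_isIdempotentElem_of_norm_lt_one {C : Type*} [CStarAlgebra C]
    {p : C} (hp : IsSelfAdjoint p) (hp' : IsIdempotentElem p) (h : ‖p‖ < 1) : p = 0 := by
  have h1 : ‖p‖ = ‖p‖ * ‖p‖ := by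
    conv_lhs => rw [← hp'.eq]
    nth_rewrite 1 [← hp.star_eq]
    exact CStarRing.norm_star_mul_self
  rw [← norm_eq_zero]
  nlinarith [norm_nonneg p]

variable {ι : Type v} {A : ι → Type u} [∀ i, CStarAlgebra (A i)]

/-- A *-homomorphism from a semiprojective unital C*-algebra to the universal C*-algebra of an
increasing union of sets of relations lifts to one with finitely many sets of relations, and it
remains unital. -/
theorem IsSemiprojective.exists_unital_lift {B : Type max u v} [CStarAlgebra B]
    (hB : IsSemiprojective B) {R : ℕ → Set (FamPoly A)} (hR : Monotone R)
    {T : Set (FamPoly A)} (hT : T = ⋃ n, R n) (hRT : ∀ n, R n ⊆ T)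
    (φ : B →⋆ₐ[ℂ] UniversalCStar A T) :
    ∃ (n : ℕ) (ψ : B →⋆ₐ[ℂ] UniversalCStar A (R n)),
      (UniversalCStar.factor (hRT n)).comp ψ = φ := by
  have hS : ∀ n, ∅ ⊆ R n := fun n => Set.empty_subset _
  have hST : ∅ ⊆ T := Set.empty_subset _
  let f : UniversalCStar A ∅ →⋆ₐ[ℂ] UniversalCStar A T := UniversalCStar.factor hST
  have hf : Function.Surjective f := UniversalCStar.factor_surjective hST
  let φ' : B →⋆ₙₐ[ℂ] f.kerIdeal.Quot :=
    ((f.quotKerEquiv hf).symm : UniversalCStar A T →⋆ₙₐ[ℂ] f.kerIdeal.Quot).comp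
      (φ : B →⋆ₙₐ[ℂ] UniversalCStar A T)
  -- The ambient algebra is the free product, and the ideals are the kernels of its maps to the
  -- successive quotients.
  obtain ⟨n, ψ, hψ⟩ := hB.2 (UniversalCStar A ∅)
    (fun n => (UniversalCStar.factor (hS n)).kerIdeal) f.kerIdeal
    (UniversalCStar.kerIdeal_factor_mono hR hS)
    (UniversalCStar.kerIdeal_factor_eq_closure hR hS hT hST) φ'
  let ψ' : B →⋆ₙₐ[ℂ] UniversalCStar A (R n) := (UniversalCStar.factor (hS n)).kerLift.comp ψ
  have hψ' : ∀ b, UniversalCStar.factor (hRT n) (ψ' b) = φ b := by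
    intro b
    have h1 : f.kerLift (φ' b) = φ b := f.kerLift_quotKerEquiv_symm hf _
    rw [← h1, ← hψ]
    rw [NonUnitalStarAlgHom.comp_apply, NonUnitalStarAlgHom.comp_apply]
    obtain ⟨x, hx⟩ := ClosedIdeal.toQuot_surjective _ (ψ b)
    rw [← hx]
    exact UniversalCStar.factor_factor (hS n) (hRT n) x
  -- The lift need not be unital. Its defect `1 - ψ' 1` is a projection that dies in the limit, so
  -- its norm is below 1 at some later stage `m`, where it must vanish.
  obtain ⟨x, hx⟩ := UniversalCStar.factor_surjective (hS n) (1 - ψ' 1)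
  have hx0 : UniversalCStar.factor hST x = 0 := by
    rw [← UniversalCStar.factor_factor (hS n) (hRT n), hx, map_sub, hψ', map_one, map_one, sub_self]
  obtain ⟨m, hm, hnm⟩ := ((UniversalCStar.exists_norm_factor_lt hR hS hT hST hx0 one_pos).and
    (eventually_ge_atTop n)).exists
  have hidem : IsIdempotentElem (ψ' 1) := by
    rw [IsIdempotentElem, ← map_mul, one_mul]
  have hsa : IsSelfAdjoint (ψ' 1) := by
    rw [IsSelfAdjoint, ← map_star, star_one]
  let q := UniversalCStar.factor (hR hnm)
  have hqx : UniversalCStar.factor (hS m) x = q (1 - ψ' 1) := by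
    rw [← hx]; exact (UniversalCStar.factor_factor (hS n) (hR hnm) x).symm
  rw [hqx] at hm
  have hq : q (1 - ψ' 1) = 0 :=
    IsSelfAdjoint.eq_zero_of_isIdempotentElem_of_norm_lt_one
      (((IsSelfAdjoint.one _).sub hsa).map q) (hidem.one_sub.map q) hm
  have hone : q (ψ' 1) = 1 := by
    rw [map_sub, map_one, sub_eq_zero] at hq
    exact hq.symm
  let χ : B →⋆ₙₐ[ℂ] UniversalCStar A (R m) :=
    (q : UniversalCStar A (R n) →⋆ₙₐ[ℂ] UniversalCStar A (R m)).comp ψ'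
  refine ⟨m, { χ with map_one' := hone, commutes' := fun c => ?_ }, ?_⟩
  · change χ _ = _
    rw [Algebra.algebraMap_eq_smul_one, map_smul, Algebra.algebraMap_eq_smul_one]
    congr 1
  · ext b
    exact (UniversalCStar.factor_factor (hR hnm) (hRT m) (ψ' b)).trans (hψ' b)

end Lifting

/-! ### Universal C*-algebras generated by `A` and copies of `P` -/

noncomputable section

namespace CopiesUniversal

open UniversalCStar

section Relations

variable {A P : Type u} {I : Type v}

/-- The commutation relations between the algebras with index in a given set. -/
def commRelationsOn (s : Set (Option I)) : Set (FamPoly (copiesFamily A P I)) :=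
  {r | ∃ (i j : Option I) (a : copiesFamily A P I i) (b : copiesFamily A P I j), i ≠ j ∧
    i ∈ s ∧ j ∈ s ∧ r = gen i a * gen j b - gen j b * gen i a}

theorem commRelationsOn_mono : Monotone (commRelationsOn (A := A) (P := P) (I := I)) :=
  fun _ _ h _ ⟨i, j, a, b, hij, hi, hj, hr⟩ => ⟨i, j, a, b, hij, h hi, h hj, hr⟩

theorem commRelationsOn_univ :
    commRelationsOn (Set.univ : Set (Option I)) = commRelations (copiesFamily A P I) := by
  ext r
  constructor
  · rintro ⟨i, j, a, b, hij, -, -, hr⟩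
    exact ⟨i, j, a, b, hij, hr⟩
  · rintro ⟨i, j, a, b, hij, hr⟩
    exact ⟨i, j, a, b, hij, trivial, trivial, hr⟩

/-- The indices of `A` and of the first `m` copies of `P`. -/
def initial (m : ℕ) : Set (Option ℕ) := {o | ∀ k ∈ o, k < m}

theorem initial_mono : Monotone initial := fun _ _ h _ ho k hk => (ho k hk).trans_le h

theorem iUnion_commRelationsOn_initial :
    commRelations (copiesFamily A P ℕ) = ⋃ m, commRelationsOn (initial m) := by
  rw [← commRelationsOn_univ]
  refine Set.Subset.antisymm ?_ (Set.iUnion_subset fun m =>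
    commRelationsOn_mono (Set.subset_univ _))
  have h : ∀ o : Option ℕ, ∃ m, o ∈ initial m := by
    rintro (_ | k)
    · exact ⟨0, by simp [initial]⟩
    · exact ⟨k + 1, by simp [initial]⟩
  rintro r ⟨i, j, a, b, hij, -, -, hr⟩
  obtain ⟨m, hm⟩ := h i
  obtain ⟨n, hn⟩ := h j
  exact Set.mem_iUnion.2 ⟨max m n, i, j, a, b, hij, initial_mono (le_max_left _ _) hm,
    initial_mono (le_max_right _ _) hn, hr⟩

end Relations

variable {A P : Type u} [CStarAlgebra A] [CStarAlgebra P] {I : Type v}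
  {R : Set (FamPoly (copiesFamily A P I))}

/-- The copy of `A` in a universal C*-algebra generated by `A` and copies of `P`. -/
def ofBase : A →⋆ₐ[ℂ] UniversalCStar (copiesFamily A P I) R :=
  of (A := copiesFamily A P I) (none : Option I)

/-- The copies of `P` in a universal C*-algebra generated by `A` and copies of `P`. -/
def ofCopy (i : I) : P →⋆ₐ[ℂ] UniversalCStar (copiesFamily A P I) R :=
  of (A := copiesFamily A P I) (some i)

/-- A family of *-homomorphisms defined on `A` and on copies of `P`. -/
def family {C : Type w} [CStarAlgebra C] (f : A →⋆ₐ[ℂ] C) (g : I → P →⋆ₐ[ℂ] C) :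
    ∀ o : Option I, copiesFamily A P I o →⋆ₐ[ℂ] C
  | none => f
  | some i => g i

theorem hom_ext_copies {C : Type w} [CStarAlgebra C]
    {g h : UniversalCStar (copiesFamily A P I) R →⋆ₐ[ℂ] C}
    (H : ∀ a, g (ofBase a) = h (ofBase a)) (H' : ∀ i p, g (ofCopy i p) = h (ofCopy i p)) :
    g = h := by
  refine hom_ext (A := copiesFamily A P I) fun o => ?_
  cases o with
  | none => exact H
  | some i => exact H' i

theorem evalPoly_family_eq_zero {C : Type w} [CStarAlgebra C] {f : A →⋆ₐ[ℂ] C}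
    {g : I → P →⋆ₐ[ℂ] C} {s : Set (Option I)}
    (h : none ∈ s → ∀ i, some i ∈ s → ∀ a p, Commute (f a) (g i p))
    (h' : ∀ i j, some i ∈ s → some j ∈ s → i ≠ j → ∀ p q, Commute (g i p) (g j q))
    {r : FamPoly (copiesFamily A P I)} (hr : r ∈ commRelationsOn s) :
    evalPoly (family f g) r = 0 := by
  obtain ⟨i, j, a, b, hij, hi, hj, rfl⟩ := hr
  rw [map_sub, map_mul, map_mul, evalPoly_gen, evalPoly_gen, sub_eq_zero]
  match i, j with
  | none, none => exact absurd rfl hij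
  | none, some j => exact h hi j hj a b
  | some i, none => exact (h hj i hi b a).symm
  | some i, some j => exact h' i j hi hj (fun e => hij (congrArg some e)) a b

/-- The universal property, with partial commutation relations. -/
def liftOn {C : Type w} [CStarAlgebra C] {s : Set (Option I)} (f : A →⋆ₐ[ℂ] C)
    (g : I → P →⋆ₐ[ℂ] C)
    (h : none ∈ s → ∀ i, some i ∈ s → ∀ a p, Commute (f a) (g i p))
    (h' : ∀ i j, some i ∈ s → some j ∈ s → i ≠ j → ∀ p q, Commute (g i p) (g j q)) :
    UniversalCStar (copiesFamily A P I) (commRelationsOn s) →⋆ₐ[ℂ] C :=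
  lift (family f g) fun _ hr => evalPoly_family_eq_zero h h' hr

section

variable {C : Type w} [CStarAlgebra C] {s : Set (Option I)} {f : A →⋆ₐ[ℂ] C}
    {g : I → P →⋆ₐ[ℂ] C}
    {h : none ∈ s → ∀ i, some i ∈ s → ∀ a p, Commute (f a) (g i p)}
    {h' : ∀ i j, some i ∈ s → some j ∈ s → i ≠ j → ∀ p q, Commute (g i p) (g j q)}

@[simp] theorem liftOn_ofBase (a : A) : liftOn f g h h' (ofBase a) = f a :=
  lift_of (A := copiesFamily A P I) (family f g) _ (none : Option I) a

@[simp] theorem liftOn_ofCopy (i : I) (p : P) : liftOn f g h h' (ofCopy i p) = g i p :=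
  lift_of (A := copiesFamily A P I) (family f g) _ (some i) p

end

/-- The universal property of the free product. -/
def liftFree {C : Type w} [CStarAlgebra C] (f : A →⋆ₐ[ℂ] C) (g : I → P →⋆ₐ[ℂ] C) :
    FreeCopies A P I →⋆ₐ[ℂ] C :=
  lift (A := copiesFamily A P I) (family f g) fun _ hr => hr.elim

/-- The universal property of the maximal tensor product. -/
def liftTensor {C : Type w} [CStarAlgebra C] (f : A →⋆ₐ[ℂ] C) (g : I → P →⋆ₐ[ℂ] C)
    (h : ∀ i a p, Commute (f a) (g i p))
    (h' : ∀ i j, i ≠ j → ∀ p q, Commute (g i p) (g j q)) : TensorCopies A P I →⋆ₐ[ℂ] C :=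
  lift (family f g) fun _ hr => evalPoly_family_eq_zero (s := Set.univ) (fun _ i _ => h i)
    (fun i j _ _ => h' i j) (commRelationsOn_univ ▸ hr)

section

variable {C : Type w} [CStarAlgebra C] {f : A →⋆ₐ[ℂ] C} {g : I → P →⋆ₐ[ℂ] C}
  {h : ∀ i a p, Commute (f a) (g i p)} {h' : ∀ i j, i ≠ j → ∀ p q, Commute (g i p) (g j q)}

@[simp] theorem liftFree_ofBase (a : A) : liftFree f g (ofBase a) = f a :=
  lift_of (A := copiesFamily A P I) (family f g) _ (none : Option I) a

@[simp] theorem liftFree_ofCopy (i : I) (p : P) : liftFree f g (ofCopy i p) = g i p :=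
  lift_of (A := copiesFamily A P I) (family f g) _ (some i) p

@[simp] theorem liftTensor_ofBase (a : A) : liftTensor f g h h' (ofBase a) = f a :=
  lift_of (A := copiesFamily A P I) (family f g) _ (none : Option I) a

@[simp] theorem liftTensor_ofCopy (i : I) (p : P) : liftTensor f g h h' (ofCopy i p) = g i p :=
  lift_of (A := copiesFamily A P I) (family f g) _ (some i) p

end

@[simp] theorem copiesQuotientMap_ofBase (a : A) :
    copiesQuotientMap A P I (ofBase a) = ofBase a := freeToTensor_of (A := copiesFamily A P I) (none : Option I) a

@[simp] theorem copiesQuotientMap_ofCopy (i : I) (p : P) :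
    copiesQuotientMap A P I (ofCopy i p) = ofCopy i p := freeToTensor_of (A := copiesFamily A P I) (some i) p

@[simp] theorem factor_ofBase {S : Set (FamPoly (copiesFamily A P I))} (h : R ⊆ S) (a : A) :
    factor h (ofBase a) = ofBase a := factor_of (A := copiesFamily A P I) h (none : Option I) a

@[simp] theorem factor_ofCopy {S : Set (FamPoly (copiesFamily A P I))} (h : R ⊆ S) (i : I)
    (p : P) : factor h (ofCopy i p) = ofCopy i p := factor_of (A := copiesFamily A P I) h (some i) p

theorem commute_ofBase_ofCopy (i : I) (a : A) (p : P) :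
    Commute (ofBase a : TensorCopies A P I) (ofCopy i p) :=
  MaxTensorProduct.of_commute (A := copiesFamily A P I) (Option.some_ne_none i).symm a p

theorem commute_ofCopy_ofCopy {i j : I} (h : i ≠ j) (p q : P) :
    Commute (ofCopy i p : TensorCopies A P I) (ofCopy j q) :=
  MaxTensorProduct.of_commute (A := copiesFamily A P I)
    (fun e => h (Option.some_injective _ e)) p q

/-- An element commutes with the whole of a universal C*-algebra as soon as it commutes with the
generators. -/
theorem commute_map_of_commute_of {ι : Type v} {B : ι → Type u} [∀ i, CStarAlgebra (B i)]
    {S : Set (FamPoly B)} {C : Type w} [CStarAlgebra C] (f : UniversalCStar B S →⋆ₐ[ℂ] C) {c : C}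
    (h : ∀ i b, Commute (f (of i b)) c) (x : UniversalCStar B S) : Commute (f x) c := by
  refine denseRange_mk.induction_on x (isClosed_eq (f.continuous_of_cstarAlgebra.mul_const c)
    (f.continuous_of_cstarAlgebra.const_mul c)) fun a => ?_
  induction a using StarPoly.induction with
  | h_scalar c' => rw [AlgHom.commutes, AlgHomClass.commutes]; exact Algebra.commutes c' c
  | h_gen y => exact h y.1 y.2
  | h_mul a b ha hb => rw [map_mul, map_mul]; exact ha.mul_left hb
  | h_add a b ha hb => rw [map_add, map_add]; exact ha.add_left hb

/-! ### Absorbing a tensorially self-absorbing algebra -/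

section Absorb

variable (A) {I : Type v} (θ : P ≃⋆ₐ[ℂ] InfiniteTensorPower P) (ε : ℕ ≃ I × ℕ)

/-- The copy of `P` with index `j` in `P`, seen as an infinite tensor power of itself. -/
def slot (j : ℕ) : P →⋆ₐ[ℂ] P :=
  (θ.symm : InfiniteTensorPower P →⋆ₐ[ℂ] P).comp (of (A := fun _ : ℕ => P) j)

theorem commute_slot {i j : ℕ} (h : i ≠ j) (p q : P) : Commute (slot θ i p) (slot θ j q) :=
  (MaxTensorProduct.of_commute (A := fun _ : ℕ => P) h p q).map
    (θ.symm : InfiniteTensorPower P →⋆ₐ[ℂ] P)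

/-- The slots generate `P`, because `θ` identifies them with the factors of the infinite tensor
power. -/
theorem hom_ext_slot {C : Type w} [CStarAlgebra C] {g h : P →⋆ₐ[ℂ] C}
    (H : ∀ j p, g (slot θ j p) = h (slot θ j p)) (p : P) : g p = h p := by
  have := hom_ext (A := fun _ : ℕ => P) (g := g.comp (θ.symm : InfiniteTensorPower P →⋆ₐ[ℂ] P))
    (h := h.comp (θ.symm : InfiniteTensorPower P →⋆ₐ[ℂ] P)) H
  simpa using DFunLike.congr_fun this (θ p)

/-- Grouping the factors of a sequence of copies of `P`, in the free product. -/
def groupFree : FreeCopies A P ℕ →⋆ₐ[ℂ] FreeCopies A P I :=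
  liftFree ofBase fun j => (ofCopy (ε j).1).comp (slot θ (ε j).2)

/-- Grouping the factors of a sequence of copies of `P`, in the tensor product. -/
def groupTensor : TensorCopies A P ℕ →⋆ₐ[ℂ] TensorCopies A P I :=
  liftTensor ofBase (fun j => (ofCopy (ε j).1).comp (slot θ (ε j).2))
    (fun _ _ _ => commute_ofBase_ofCopy _ _ _)
    (fun i j hij p q => by
      -- Two copies put in the same target copy occupy different slots of it; otherwise they lie in
      -- different, commuting copies.
      by_cases h : (ε i).1 = (ε j).1
      · have h2 : (ε i).2 ≠ (ε j).2 := fun h2 => hij (ε.injective (Prod.ext h h2))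
        simp only [StarAlgHom.comp_apply, h]
        exact (commute_slot θ h2 p q).map _
      · exact commute_ofCopy_ofCopy h _ _)

@[simp] theorem groupTensor_ofBase (a : A) : groupTensor A θ ε (ofBase a) = ofBase a :=
  liftTensor_ofBase a

@[simp] theorem groupTensor_ofCopy (j : ℕ) (p : P) :
    groupTensor A θ ε (ofCopy j p) = ofCopy (ε j).1 (slot θ (ε j).2 p) :=
  liftTensor_ofCopy j p

/-- Splitting a copy of `P` into a sequence of copies. -/
def splitCopy (i : I) : P →⋆ₐ[ℂ] TensorCopies A P ℕ :=
  (lift (A := fun _ : ℕ => P) (fun k => ofCopy (ε.symm (i, k))) (by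
    rintro _ ⟨k, l, a, b, hkl, rfl⟩
    rw [map_sub, map_mul, map_mul, evalPoly_gen, evalPoly_gen, sub_eq_zero]
    exact commute_ofCopy_ofCopy (fun e => hkl (Prod.ext_iff.1 (ε.symm.injective e)).2) a b)).comp
    (θ : P →⋆ₐ[ℂ] InfiniteTensorPower P)

theorem splitCopy_slot (i : I) (k : ℕ) (p : P) :
    splitCopy A θ ε i (slot θ k p) = ofCopy (ε.symm (i, k)) p := by
  simp [splitCopy, slot]

theorem commute_splitCopy {i : I} {c : TensorCopies A P ℕ}
    (h : ∀ k p, Commute (ofCopy (ε.symm (i, k)) p) c) (p : P) :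
    Commute (splitCopy A θ ε i p) c :=
  commute_map_of_commute_of (B := fun _ : ℕ => P)
    ((splitCopy A θ ε i).comp (θ.symm : InfiniteTensorPower P →⋆ₐ[ℂ] P))
    (fun k q => by
      change Commute (splitCopy A θ ε i (slot θ k q)) c
      rw [splitCopy_slot]; exact h k q) (θ p) |> fun h => by simpa using h

/-- Splitting all the copies of `P` into sequences of copies, in the tensor product. -/
def splitTensor : TensorCopies A P I →⋆ₐ[ℂ] TensorCopies A P ℕ :=
  liftTensor ofBase (splitCopy A θ ε)
    (fun _ a p => (commute_splitCopy A θ ε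
      (fun _ q => (commute_ofBase_ofCopy _ a q).symm) p).symm)
    (fun _ _ hij p q => commute_splitCopy A θ ε (fun _ p => (commute_splitCopy A θ ε
      (fun _ q => commute_ofCopy_ofCopy
        (fun e => hij (Prod.ext_iff.1 (ε.symm.injective e)).1.symm) q p) q).symm) p)

theorem groupTensor_splitTensor :
    (groupTensor A θ ε).comp (splitTensor A θ ε) = StarAlgHom.id ℂ _ := by
  refine hom_ext_copies (fun a => by simp [splitTensor]) fun i => ?_
  refine hom_ext_slot θ (g := ((groupTensor A θ ε).comp (splitTensor A θ ε)).comp (ofCopy i))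
    (h := (StarAlgHom.id ℂ _).comp (ofCopy i)) fun k p => ?_
  simp [splitTensor, splitCopy_slot]

theorem splitTensor_groupTensor :
    (splitTensor A θ ε).comp (groupTensor A θ ε) = StarAlgHom.id ℂ _ := by
  refine hom_ext_copies (fun a => by simp [splitTensor]) fun j p => ?_
  simp [splitTensor, splitCopy_slot]

/-- The maximal tensor product of `A` and copies of a self-absorbing `P` does not depend on the
number of copies. -/
def tensorEquiv : TensorCopies A P ℕ ≃⋆ₐ[ℂ] TensorCopies A P I :=
  StarAlgEquiv.ofStarAlgHom (groupTensor A θ ε) (splitTensor A θ ε)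
    (splitTensor_groupTensor A θ ε) (groupTensor_splitTensor A θ ε)

/-- This naturality transports sections. Only the tensor-product side of the square needs to be
invertible. -/
theorem copiesQuotientMap_comp_groupFree :
    (copiesQuotientMap A P I).comp (groupFree A θ ε) =
      (groupTensor A θ ε).comp (copiesQuotientMap A P ℕ) :=
  hom_ext_copies (fun a => by simp [groupFree])
    fun j p => by simp [groupFree]

end Absorb

/-- A splitting for a sequence of copies of a self-absorbing algebra yields one for any nonzero
number of copies. -/
theorem exists_section_of_exists_section_nat {I : Type v}
    (θ : P ≃⋆ₐ[ℂ] InfiniteTensorPower P) (ε : ℕ ≃ I × ℕ)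
    (h : ∃ σ : TensorCopies A P ℕ →⋆ₐ[ℂ] FreeCopies A P ℕ,
      (copiesQuotientMap A P ℕ).comp σ = StarAlgHom.id ℂ _) :
    ∃ σ : TensorCopies A P I →⋆ₐ[ℂ] FreeCopies A P I,
      (copiesQuotientMap A P I).comp σ = StarAlgHom.id ℂ _ := by
  obtain ⟨σ, hσ⟩ := h
  refine ⟨(groupFree A θ ε).comp (σ.comp (splitTensor A θ ε)), ?_⟩
  rw [← StarAlgHom.comp_assoc, copiesQuotientMap_comp_groupFree, StarAlgHom.comp_assoc,
    ← StarAlgHom.comp_assoc _ σ, hσ, StarAlgHom.id_comp, groupTensor_splitTensor]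

theorem exists_section_of_isEmpty (A P : Type u) [CStarAlgebra A] [CStarAlgebra P] (I : Type v)
    [IsEmpty I] : ∃ σ : TensorCopies A P I →⋆ₐ[ℂ] FreeCopies A P I,
      (copiesQuotientMap A P I).comp σ = StarAlgHom.id ℂ _ :=
  ⟨liftTensor ofBase isEmptyElim isEmptyElim isEmptyElim,
    hom_ext_copies (fun a => by simp) isEmptyElim⟩

/-! ### Removing finitely many commutation relations -/

section Shift

variable {m : ℕ}

variable (α : TensorCopies A P (Fin m) →⋆ₐ[ℂ] A)

/-- The copies of `P`, the first `m` of which are absorbed by `A`. -/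
def absorbCopy (α : TensorCopies A P (Fin m) →⋆ₐ[ℂ] A)
    (R : Set (FamPoly (copiesFamily A P ℕ))) (k : ℕ) :
    P →⋆ₐ[ℂ] UniversalCStar (copiesFamily A P ℕ) R :=
  if h : k < m then ofBase.comp (α.comp (ofCopy ⟨k, h⟩)) else ofCopy (k - m)

theorem absorbCopy_of_lt {R : Set (FamPoly (copiesFamily A P ℕ))} (k : Fin m) (p : P) :
    absorbCopy α R k p = ofBase (α (ofCopy k p)) := by
  simp [absorbCopy]

theorem absorbCopy_add {R : Set (FamPoly (copiesFamily A P ℕ))} (k : ℕ) (p : P) : absorbCopy α R (m + k) p = ofCopy k p := by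
  simp [absorbCopy]

theorem some_mem_initial {k : ℕ} : some k ∈ initial m ↔ k < m := by simp [initial]

/-- Absorbing the first `m` copies of `P`, which commute with each other and with `A`, into `A`. -/
def absorb : UniversalCStar (copiesFamily A P ℕ) (commRelationsOn (initial m)) →⋆ₐ[ℂ]
    FreeCopies A P ℕ :=
  liftOn (ofBase.comp (α.comp ofBase)) (absorbCopy α ∅)
    (fun _ i hi a p => by
      lift i to Fin m using some_mem_initial.1 hi
      rw [absorbCopy_of_lt]
      exact ((commute_ofBase_ofCopy i a p).map α).map ofBase)
    (fun i j hi hj hij p q => by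
      lift i to Fin m using some_mem_initial.1 hi
      lift j to Fin m using some_mem_initial.1 hj
      rw [absorbCopy_of_lt, absorbCopy_of_lt]
      exact ((commute_ofCopy_ofCopy (fun e => hij (congrArg _ e)) p q).map α).map ofBase)

/-- Absorbing the first `m` copies of `P` into `A`, in the tensor product. -/
def absorbTensor : TensorCopies A P ℕ →⋆ₐ[ℂ] TensorCopies A P ℕ :=
  liftTensor (ofBase.comp (α.comp ofBase)) (absorbCopy α _)
    (fun i a p => by
      rcases lt_or_ge i m with hi | hi
      · lift i to Fin m using hi
        rw [absorbCopy_of_lt]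
        exact ((commute_ofBase_ofCopy i a p).map α).map ofBase
      · obtain ⟨k, rfl⟩ := Nat.exists_eq_add_of_le hi
        rw [absorbCopy_add]
        exact commute_ofBase_ofCopy _ _ _)
    (fun i j hij p q => by
      rcases lt_or_ge i m with hi | hi <;> rcases lt_or_ge j m with hj | hj
      · lift i to Fin m using hi
        lift j to Fin m using hj
        rw [absorbCopy_of_lt, absorbCopy_of_lt]
        exact ((commute_ofCopy_ofCopy (fun e => hij (congrArg _ e)) p q).map α).map ofBase
      · lift i to Fin m using hi
        obtain ⟨k, rfl⟩ := Nat.exists_eq_add_of_le hj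
        rw [absorbCopy_of_lt, absorbCopy_add]
        exact commute_ofBase_ofCopy _ _ _
      · lift j to Fin m using hj
        obtain ⟨k, rfl⟩ := Nat.exists_eq_add_of_le hi
        rw [absorbCopy_of_lt, absorbCopy_add]
        exact (commute_ofBase_ofCopy _ _ _).symm
      · obtain ⟨k, rfl⟩ := Nat.exists_eq_add_of_le hi
        obtain ⟨l, rfl⟩ := Nat.exists_eq_add_of_le hj
        rw [absorbCopy_add, absorbCopy_add]
        exact commute_ofCopy_ofCopy (fun e => hij (congrArg _ e)) p q)

/-- Absorption is compatible with imposing the remaining commutation relations, so a section of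
`factor h` can be carried to one of the original quotient map. -/
theorem copiesQuotientMap_comp_absorb
    (h : commRelationsOn (initial m) ⊆ commRelations (copiesFamily A P ℕ)) :
    (copiesQuotientMap A P ℕ).comp (absorb α) = (absorbTensor α).comp (factor h) := by
  refine hom_ext_copies (fun a => by simp [absorb, absorbTensor]) fun k p => ?_
  rcases lt_or_ge k m with hk | hk
  · lift k to Fin m using hk
    simp [absorb, absorbTensor, absorbCopy_of_lt]
  · obtain ⟨k, rfl⟩ := Nat.exists_eq_add_of_le hk
    simp [absorb, absorbTensor, absorbCopy_add]

/-- The tensor product of `A` and the first `m` copies of `P`, inside the one of all copies. -/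
def initialTensor (m : ℕ) : TensorCopies A P (Fin m) →⋆ₐ[ℂ] TensorCopies A P ℕ :=
  liftTensor ofBase (fun k => ofCopy (k : ℕ)) (fun _ => commute_ofBase_ofCopy _)
    (fun _ _ hij => commute_ofCopy_ofCopy (Fin.val_injective.ne hij))

theorem absorbTensor_initialTensor (x : TensorCopies A P (Fin m)) :
    absorbTensor α (initialTensor m x) = ofBase (α x) := by
  refine DFunLike.congr_fun (hom_ext_copies (g := (absorbTensor α).comp (initialTensor m))
    (h := ofBase.comp α) (fun a => ?_) fun k p => ?_) x
  · simp [absorbTensor, initialTensor]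
  · simp [absorbTensor, initialTensor, absorbCopy_of_lt]

/-- Expanding `A` to the tensor product of `A` and the first `m` copies of `P`. -/
def expandTensor (β : A →⋆ₐ[ℂ] TensorCopies A P (Fin m)) :
    TensorCopies A P ℕ →⋆ₐ[ℂ] TensorCopies A P ℕ :=
  liftTensor ((initialTensor m).comp β) (fun k => ofCopy (m + k))
    -- The image of `β` lies in the subalgebra generated by `A` and the copies with index below `m`,
    -- and the copy with index `m + k` commutes with it.
    (fun k a p => commute_map_of_commute_of (initialTensor m) (fun o b => by
      cases o with
      | none =>
        change Commute (initialTensor m (ofBase b)) _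
        rw [initialTensor, liftTensor_ofBase]
        exact commute_ofBase_ofCopy _ _ _
      | some i =>
        change Commute (initialTensor m (ofCopy i b)) _
        rw [initialTensor, liftTensor_ofCopy]
        exact commute_ofCopy_ofCopy (by have := i.2; omega) _ _) (β a))
    (fun _ _ hij => commute_ofCopy_ofCopy (by omega))

@[simp] theorem expandTensor_ofBase (β : A →⋆ₐ[ℂ] TensorCopies A P (Fin m)) (a : A) :
    expandTensor β (ofBase a) = initialTensor m (β a) := liftTensor_ofBase a

@[simp] theorem expandTensor_ofCopy (β : A →⋆ₐ[ℂ] TensorCopies A P (Fin m)) (k : ℕ) (p : P) :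
    expandTensor β (ofCopy k p) = ofCopy (m + k) p := liftTensor_ofCopy k p

theorem absorbTensor_comp_expandTensor (β : A →⋆ₐ[ℂ] TensorCopies A P (Fin m))
    (h : ∀ a, α (β a) = a) : (absorbTensor α).comp (expandTensor β) = StarAlgHom.id ℂ _ := by
  refine hom_ext_copies (fun a => ?_) fun k p => ?_
  · simp [absorbTensor_initialTensor, h]
  · simp [absorbTensor, absorbCopy_add]

end Shift

/-- Lifting `e` splits the quotient map from a partially commuting algebra; absorbing the commuting
copies into `A` then removes the finitely many blocks of commutation relations that are left. -/
theorem exists_section_nat (hA : IsSemiprojective A) (e : A ≃⋆ₐ[ℂ] TensorCopies A P ℕ)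
    (α : ∀ m : ℕ, A ≃⋆ₐ[ℂ] TensorCopies A P (Fin (m + 1))) :
    ∃ σ : TensorCopies A P ℕ →⋆ₐ[ℂ] FreeCopies A P ℕ,
      (copiesQuotientMap A P ℕ).comp σ = StarAlgHom.id ℂ _ := by
  -- Starting with one copy keeps `Fin (m + 1)` nonempty, as the regrouping behind `α` requires; the
  -- union is unaffected.
  have hR : Monotone fun m : ℕ => commRelationsOn (A := A) (P := P) (initial (m + 1)) :=
    fun m n h => commRelationsOn_mono (initial_mono (Nat.succ_le_succ h))
  have hT : commRelations (copiesFamily A P ℕ) = ⋃ m, commRelationsOn (initial (m + 1)) := by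
    rw [iUnion_commRelationsOn_initial]
    exact ((commRelationsOn_mono.comp initial_mono).iUnion_nat_add 1).symm
  have hRT : ∀ m : ℕ, commRelationsOn (initial (m + 1)) ⊆ commRelations (copiesFamily A P ℕ) :=
    fun m => by
      rw [← commRelationsOn_univ]
      exact commRelationsOn_mono (Set.subset_univ _)
  obtain ⟨m, ψ, hψ⟩ := hA.exists_unital_lift hR hT hRT
    (e : A →⋆ₐ[ℂ] TensorCopies A P ℕ)
  let s := ψ.comp (e.symm : TensorCopies A P ℕ →⋆ₐ[ℂ] A)
  have hs : (factor (hRT m)).comp s = StarAlgHom.id ℂ _ := by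
    rw [← StarAlgHom.comp_assoc, hψ]
    ext x
    exact e.apply_symm_apply x
  let a : TensorCopies A P (Fin (m + 1)) →⋆ₐ[ℂ] A := ((α m).symm : _ →⋆ₐ[ℂ] A)
  let b : A →⋆ₐ[ℂ] TensorCopies A P (Fin (m + 1)) := (α m : A →⋆ₐ[ℂ] _)
  refine ⟨(absorb a).comp (s.comp (expandTensor b)), ?_⟩
  -- Moving the quotient map past `absorb` makes `factor` meet its section `s`. What remains is
  -- expansion followed by absorption, the identity because `a` inverts `b`.
  rw [← StarAlgHom.comp_assoc, copiesQuotientMap_comp_absorb a (hRT m), StarAlgHom.comp_assoc,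
    ← StarAlgHom.comp_assoc _ s, hs, StarAlgHom.id_comp]
  exact absorbTensor_comp_expandTensor a b (α m).symm_apply_apply

end CopiesUniversal

end

theorem mainTheorem4 {A P : Type u} [CStarAlgebra A] [CStarAlgebra P]
    [TopologicalSpace.SeparableSpace A] [TopologicalSpace.SeparableSpace P]
    (hP : Nonempty (P ≃⋆ₐ[ℂ] InfiniteTensorPower P))
    (hA : IsSemiprojective A)
    (hAP : Nonempty (TensorPair A P ≃⋆ₐ[ℂ] A)) :
    (∃ σ : TensorCopies A P ℕ →⋆ₐ[ℂ] FreeCopies A P ℕ,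
      (copiesQuotientMap A P ℕ).comp σ = StarAlgHom.id ℂ (TensorCopies A P ℕ)) ∧
    ∀ n : ℕ, ∃ σ : TensorCopies A P (Fin n) →⋆ₐ[ℂ] FreeCopies A P (Fin n),
      (copiesQuotientMap A P (Fin n)).comp σ = StarAlgHom.id ℂ (TensorCopies A P (Fin n)) := by
  obtain ⟨θ⟩ := hP
  obtain ⟨κ⟩ := hAP
  have hε : ∀ (I : Type) [Countable I] [Nonempty I], Nonempty (ℕ ≃ I × ℕ) := fun I _ _ =>
    nonempty_equiv_of_countable
  -- One copy of `P` regroups into a sequence of copies, so `A ≅ A ⊗ P` becomes `A ≅ A ⊗ P^{⊗∞}`.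
  let e : A ≃⋆ₐ[ℂ] TensorCopies A P ℕ :=
    κ.symm.trans (CopiesUniversal.tensorEquiv A θ (hε Unit).some).symm
  have h := CopiesUniversal.exists_section_nat hA e fun m =>
    e.trans (CopiesUniversal.tensorEquiv A θ (hε (Fin (m + 1))).some)
  refine ⟨h, fun n => ?_⟩
  -- Without copies of `P` there is nothing to group into, but both algebras are then generated by
  -- `A` alone and no commutation is needed.
  cases n with
  | zero => exact CopiesUniversal.exists_section_of_isEmpty A P (Fin 0)
  | succ n => exact CopiesUniversal.exists_section_of_exists_section_nat θ (hε _).some h
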